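/- Let $f(x)=x^{12}+ax^6+b\in\mathbb{Q}[x]$ be irreducible, and let $r(x)=x^3-3bx+ab$. Galois groups of polynomials over $\mathbb{Q}$ are regarded as permutation groups on the roots, up to conjugacy (relabelling of the roots), and $nTj$ denotes the $j$-th transitive group of degree $n$ in the standard numbering: $4T3$ and $6T3$ are the dihedral groups of orders $8$ and $12$ acting on the vertices of a square and of a regular hexagon, $12T12$ is the dihedral group of order $24$ acting on the vertices of a regular $12$-gon, and $12T13$ is the group of order $24$ (isomorphic to $C_3\rtimes D_4$) consisting of the permutations $x\mapsto mx+k$ of $\mathbb{Z}/12\mathbb{Z}$ with either $m\equiv\pm1$ and $k$ even, or $m\equiv\pm5$ and $k$ odd. Assume that $x^4+ax^2+b$ has Galois group $4T3$, that $x^6+ax^3+b$ has Galois group $6T3$, and that $-3b$ or $3b(4b-a^2)$ is a square in $\mathbb{Q}$. 1. If $r(x)$ is reducible over $\mathbb{Q}$, then the Galois group of $f$ is (a) $12T12$ if $3b(4b-a^2)$ is a square in $\mathbb{Q}$; (b) $12T13$ if $-3b$ is a square in $\mathbb{Q}$. 2. If $b$ is a cube in $\mathbb{Q}$, then the Galois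 group of $f$ is (a) $12T12$ if $-3b$ is a square in $\mathbb{Q}$; (b) $12T13$ if $3b(4b-a^2)$ is a square in $\mathbb{Q}$. -/

import Mathlib

open Polynomial

/-- The natural action of the dihedral group of order `2 * n` on the vertices `ZMod n` of a
regular `n`-gon (for `n ≥ 3`), as a permutation group:
generated by the rotation `x ↦ x + 1` and the reflection `x ↦ -x`. -/
def dihedralPermGroup (n : ℕ) : Subgroup (Equiv.Perm (ZMod n)) :=
  Subgroup.closure {Equiv.addRight (1 : ZMod n), Equiv.neg (ZMod n)}

/-- The transitive group `4T3`: the dihedral group of order 8 acting on the square. -/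
def T4_3 : Subgroup (Equiv.Perm (ZMod 4)) := dihedralPermGroup 4

/-- The transitive group `6T3`: the dihedral group of order 12 acting on the hexagon. -/
def T6_3 : Subgroup (Equiv.Perm (ZMod 6)) := dihedralPermGroup 6

/-- The transitive group `12T12`: the dihedral group of order 24 acting on the 12-gon. -/
def T12_12 : Subgroup (Equiv.Perm (ZMod 12)) := dihedralPermGroup 12

/-- The permutation `x ↦ 5 * x + 1` of `ZMod 12`. -/
def affineFiveOne : Equiv.Perm (ZMod 12) where
  toFun x := 5 * x + 1
  invFun x := 5 * (x - 1)
  left_inv := by decide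
  right_inv := by decide

/-- The transitive group `12T13`, of order 24, isomorphic to `C₃ ⋊ D₄`: the permutations of
`ZMod 12` generated by `x ↦ x + 2`, `x ↦ -x` and `x ↦ 5 * x + 1`. It consists of the maps
`x ↦ m * x + k` with either `m = ±1` and `k` even, or `m = ±5` and `k` odd. -/
def T12_13 : Subgroup (Equiv.Perm (ZMod 12)) :=
  Subgroup.closure {Equiv.addRight (2 : ZMod 12), Equiv.neg (ZMod 12), affineFiveOne}

/-- The Galois group of `p` over `F`, as a permutation group on the roots of `p` in its
splitting field, is the permutation group `H` on `Y`, up to relabelling the roots by the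
elements of `Y` (that is, up to conjugacy). -/
def GaloisGroupIs {F Y : Type*} [Field F] (p : F[X]) (H : Subgroup (Equiv.Perm Y)) : Prop :=
  ∃ e : p.rootSet p.SplittingField ≃ Y,
    (MulAction.toPermHom p.Gal (p.rootSet p.SplittingField)).range.map
      e.permCongrHom.toMonoidHom = H

/-! The roots of `f` are `θ * ζ ^ l` and `φ * ζ ^ l`, with `ζ` a primitive sixth root of unity and
`θ ^ 6`, `φ ^ 6` the roots of `x² + ax + b`. An automorphism sends `ζ` to `ζ ^ (±1)` and fixes or
swaps the two families, with shifts `i` and `j` of the exponents. Two rational quantities restrict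
these shifts.

Modulo 3: if `b` is a cube, `φ` can be chosen with `(θφ)²` rational, which forces `j ≡ -i`. If `r`
has a rational root, Cardano's formula gives a `φ` with `θ⁴φ² + θ²φ⁴` rational, which forces `j ≡
i`. The sign is `w`.

Modulo 2: `(θφ)³√-3` has square `-3b`, and its product with `θ⁶ - φ⁶` has square `3b(4b - a²)`.
Whichever is rational fixes the parity of `i + j`; the sign `s` records whether swapping the
families changes it.

With a labelling by `ZMod 12` adapted to `w`, every automorphism becomes affine (`exists_affine`),
and lies in `12T12` if `w * s = -1`, in `12T13` if `w * s = 1`. The groups `4T3` and `6T3` make the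
Galois group have order at least 24 (`card_gal_ge`), so containment is equality
(`galoisGroupIs_of_forall_exists`). -/

lemma GaloisGroupIs.card_eq {F Y : Type*} [Field F] {p : F[X]} {H : Subgroup (Equiv.Perm Y)}
    (h : GaloisGroupIs p H) : Nat.card p.Gal = Nat.card H := by
  obtain ⟨e, rfl⟩ := h
  rw [Subgroup.card_map_of_injective e.permCongrHom.injective]
  have hinj : Function.Injective (MulAction.toPermHom p.Gal (p.rootSet p.SplittingField)) := by
    intro σ τ hστ
    refine Gal.ext p fun x hx => ?_
    exact congrArg Subtype.val (DFunLike.congr_fun hστ ⟨x, hx⟩)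
  exact Nat.card_congr (MonoidHom.ofInjective hinj).toEquiv

/-! ### Orders and elements of the dihedral permutation groups. -/

/-- The dihedral group acting on `ZMod n`. -/
def dihedralToPerm (n : ℕ) : DihedralGroup n →* Equiv.Perm (ZMod n) where
  toFun
    | .r i => Equiv.addRight i
    | .sr i => (Equiv.addRight i).trans (Equiv.neg _)
  map_one' := by
    ext x
    change x + 0 = x
    rw [add_zero]
  map_mul' g h := by
    rcases g with i | i <;> rcases h with j | j <;> ext x <;> simp <;> ring_nf

@[simp] lemma dihedralToPerm_r {n : ℕ} (i x : ZMod n) :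
    dihedralToPerm n (.r i) x = x + i := rfl

@[simp] lemma dihedralToPerm_sr {n : ℕ} (i x : ZMod n) :
    dihedralToPerm n (.sr i) x = -(x + i) := rfl

lemma dihedralToPerm_injective {n : ℕ} (hn : 3 ≤ n) : Function.Injective (dihedralToPerm n) := by
  have h2 : (2 : ZMod n) ≠ 0 := by
    intro h
    have : ((2 : ℕ) : ZMod n) = 0 := by exact_mod_cast h
    have := Nat.le_of_dvd (by norm_num) ((ZMod.natCast_eq_zero_iff 2 n).1 this)
    omega
  rw [injective_iff_map_eq_one]
  intro g hg
  have hx : ∀ x, dihedralToPerm n g x = x := fun x => by rw [hg]; rfl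
  rcases g with i | i
  · have := hx 0
    simp only [dihedralToPerm_r, zero_add] at this
    rw [this, DihedralGroup.one_def]
  · have h0 := hx 0
    have h1 := hx 1
    simp only [dihedralToPerm_sr] at h0 h1
    exact absurd (by linear_combination h0 - h1) h2

lemma dihedralToPerm_range (n : ℕ) [NeZero n] :
    (dihedralToPerm n).range = dihedralPermGroup n := by
  apply le_antisymm
  · have hr : ∀ i : ZMod n, dihedralToPerm n (.r i) ∈ dihedralPermGroup n := by
      intro i
      have h1 : dihedralToPerm n (.r 1) ∈ dihedralPermGroup n :=
        Subgroup.subset_closure (Or.inl rfl)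
      have := Subgroup.pow_mem _ h1 i.val
      rwa [← map_pow, DihedralGroup.r_one_pow, ZMod.natCast_zmod_val] at this
    rintro _ ⟨i | i, rfl⟩
    · exact hr i
    · exact Subgroup.mul_mem _ (Subgroup.subset_closure (Or.inr rfl) :
        Equiv.neg (ZMod n) ∈ dihedralPermGroup n) (hr i)
  · rw [dihedralPermGroup, Subgroup.closure_le]
    rintro _ (rfl | rfl)
    · exact ⟨.r 1, rfl⟩
    · exact ⟨.sr 0, by ext x; simp⟩

lemma card_dihedralPermGroup {n : ℕ} (hn : 3 ≤ n) : Nat.card (dihedralPermGroup n) = 2 * n := by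
  have : NeZero n := ⟨by omega⟩
  rw [← dihedralToPerm_range, ← DihedralGroup.nat_card]
  exact (Nat.card_congr (MonoidHom.ofInjective (dihedralToPerm_injective hn)).toEquiv).symm

lemma exists_mem_T12_12 (m n : ZMod 12) (hm : m = 1 ∨ m = -1) :
    ∃ π ∈ T12_12, ∀ x, π x = m * x + n := by
  rw [T12_12, ← dihedralToPerm_range]
  rcases hm with rfl | rfl
  · exact ⟨_, ⟨.r n, rfl⟩, fun x => by simp⟩
  · exact ⟨_, ⟨.sr (-n), rfl⟩, fun x => by simp; ring⟩

/-! ### The affine maps in `12T13`; `6 * n = 0` and `6 * n = 6` say that `n` is even or odd. -/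

/-- The pairs `(m, n)` for which `x ↦ m * x + n` belongs to `T12_13`. -/
def T12_13Pairs : Finset (ZMod 12 × ZMod 12) :=
  Finset.univ.filter fun q => ((q.1 = 1 ∨ q.1 = -1) ∧ 6 * q.2 = 0) ∨
    ((q.1 = 5 ∨ q.1 = -5) ∧ 6 * q.2 = 6)

lemma exists_pair_of_mem_T12_13 {π : Equiv.Perm (ZMod 12)} (hπ : π ∈ T12_13) :
    ∃ q ∈ T12_13Pairs, ∀ x, π x = q.1 * x + q.2 := by
  induction hπ using Subgroup.closure_induction with
  | mem π h =>
    rcases h with rfl | rfl | rfl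
    · exact ⟨(1, 2), by decide, fun x => by simp⟩
    · exact ⟨(-1, 0), by decide, fun x => by simp⟩
    · exact ⟨(5, 1), by decide, fun x => rfl⟩
  | one => exact ⟨(1, 0), by decide, fun x => by simp⟩
  | mul π ρ _ _ h₁ h₂ =>
    obtain ⟨q, hq, hπ⟩ := h₁
    obtain ⟨s, hs, hρ⟩ := h₂
    have key : ∀ q ∈ T12_13Pairs, ∀ s ∈ T12_13Pairs,
        (q.1 * s.1, q.1 * s.2 + q.2) ∈ T12_13Pairs := by decide +kernel
    exact ⟨_, key q hq s hs, fun x => by rw [Equiv.Perm.mul_apply, hπ, hρ]; ring⟩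
  | inv π _ h =>
    obtain ⟨q, hq, hπ⟩ := h
    have key : ∀ q ∈ T12_13Pairs, (q.1, -(q.1 * q.2)) ∈ T12_13Pairs ∧ q.1 * q.1 = 1 := by
      decide +kernel
    refine ⟨_, (key q hq).1, fun x => ?_⟩
    rw [Equiv.Perm.inv_eq_iff_eq, hπ]
    linear_combination (q.2 - x) * (key q hq).2

lemma card_T12_13_le : Nat.card T12_13 ≤ 24 := by
  choose q hq hπ using fun π : T12_13 => exists_pair_of_mem_T12_13 π.2
  have hinj : Function.Injective fun π : T12_13 => (⟨q π, hq π⟩ : T12_13Pairs) := by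
    intro π ρ h
    have h' : q π = q ρ := congrArg Subtype.val h
    ext x
    rw [hπ, hπ, h']
  calc Nat.card T12_13 ≤ Nat.card T12_13Pairs := Nat.card_le_card_of_injective _ hinj
    _ = 24 := by rw [Nat.card_eq_fintype_card, Fintype.card_coe]; decide +kernel

lemma exists_mem_T12_13 (m n : ZMod 12)
    (h : ((m = 1 ∨ m = -1) ∧ 6 * n = 0) ∨ ((m = 5 ∨ m = -5) ∧ 6 * n = 6)) :
    ∃ π ∈ T12_13, ∀ x, π x = m * x + n := by
  have hneg : Equiv.neg (ZMod 12) ∈ T12_13 := Subgroup.subset_closure (Or.inr (Or.inl rfl))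
  have haff : affineFiveOne ∈ T12_13 := Subgroup.subset_closure (Or.inr (Or.inr rfl))
  have hadd : Equiv.addRight (2 : ZMod 12) ∈ T12_13 := Subgroup.subset_closure (Or.inl rfl)
  have heven : ∀ k : ℕ, ∃ π ∈ T12_13, ∀ x, π x = x + 2 * k := by
    intro k
    induction k with
    | zero => exact ⟨1, Subgroup.one_mem _, fun x => by simp⟩
    | succ k ih =>
      obtain ⟨π, hπ, h⟩ := ih
      refine ⟨_, Subgroup.mul_mem _ hadd hπ, fun x => ?_⟩
      rw [Equiv.Perm.mul_apply, h, Equiv.coe_addRight]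
      push_cast
      ring
  have hhalf : ∀ n : ZMod 12, 6 * n = 0 → ∃ k : Fin 6, n = 2 * ((k : ℕ) : ZMod 12) := by
    decide +kernel
  have hpm : ∀ m : ZMod 12, (m = 1 ∨ m = -1) → ∃ π ∈ T12_13, ∀ x, π x = m * x := by
    rintro m (rfl | rfl)
    · exact ⟨1, Subgroup.one_mem _, fun x => by simp⟩
    · exact ⟨_, hneg, fun x => by simp⟩
  rcases h with ⟨hm, hn⟩ | ⟨hm, hn⟩
  · obtain ⟨k, rfl⟩ := hhalf n hn
    obtain ⟨π, hπ, h⟩ := heven k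
    obtain ⟨ρ, hρ, h'⟩ := hpm m hm
    exact ⟨_, Subgroup.mul_mem _ hπ hρ, fun x => by rw [Equiv.Perm.mul_apply, h, h']⟩
  · obtain ⟨k, hk⟩ := hhalf (n - 1) (by linear_combination hn)
    obtain ⟨π, hπ, h⟩ := heven k
    -- Since `5 * 5 = 1`, composing `x ↦ 5 * x + 1` with multiplication by `5 * m = ±1` has
    -- multiplier `m`.
    have hm' : (5 * m = 1 ∨ 5 * m = -1) ∧ 5 * (5 * m) = m := by
      revert hm; revert m; decide +kernel
    obtain ⟨ρ, hρ, h'⟩ := hpm _ hm'.1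
    refine ⟨_, Subgroup.mul_mem _ hπ (Subgroup.mul_mem _ haff hρ), fun x => ?_⟩
    rw [Equiv.Perm.mul_apply, Equiv.Perm.mul_apply, h, h']
    change 5 * (5 * m * x) + 1 + 2 * ((k : ℕ) : ZMod 12) = _
    linear_combination x * hm'.2 - hk

/-! ### Recognising the Galois group by containment and order. -/

lemma galoisGroupIs_of_forall_exists {F Y : Type*} [Field F] [Finite Y] {p : F[X]}
    {T : Subgroup (Equiv.Perm Y)} (hcard : Nat.card T ≤ Nat.card p.Gal)
    (ρ : Y → p.SplittingField) (hinj : Function.Injective ρ)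
    (hrange : Set.range ρ = p.rootSet p.SplittingField)
    (h : ∀ σ : p.Gal, ∃ π ∈ T, ∀ x, σ (ρ x) = ρ (π x)) : GaloisGroupIs p T := by
  let e : p.rootSet p.SplittingField ≃ Y :=
    ((Equiv.ofInjective ρ hinj).trans (Equiv.setCongr hrange)).symm
  have he : ∀ y : Y, ((e.symm y : p.rootSet p.SplittingField) : p.SplittingField) = ρ y :=
    fun y => rfl
  refine ⟨e, ?_⟩
  set H := (MulAction.toPermHom p.Gal (p.rootSet p.SplittingField)).range.map
    e.permCongrHom.toMonoidHom with hH
  have hHcard : Nat.card p.Gal = Nat.card H := GaloisGroupIs.card_eq ⟨e, rfl⟩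
  apply Subgroup.eq_of_le_of_card_ge
  · rintro _ ⟨_, ⟨σ, rfl⟩, rfl⟩
    obtain ⟨π, hπ, hσ⟩ := h σ
    convert hπ
    ext x
    change e (σ • e.symm x) = π x
    rw [← Equiv.eq_symm_apply]
    ext
    rw [he, ← hσ, ← he]
    rfl
  · rwa [← hHcard]

/-- `f` is the quartic composed with `X ^ 3` and the sextic composed with `X ^ 2`, so its Galois
group surjects onto groups of orders 8 and 12, whose least common multiple is 24. -/
lemma card_gal_ge {a b : ℚ}
    (hG4 : GaloisGroupIs (X ^ 4 + C a * X ^ 2 + C b : ℚ[X]) T4_3)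
    (hG6 : GaloisGroupIs (X ^ 6 + C a * X ^ 3 + C b : ℚ[X]) T6_3) :
    24 ≤ Nat.card (X ^ 12 + C a * X ^ 6 + C b : ℚ[X]).Gal := by
  have h4 : 8 ∣ Nat.card (X ^ 12 + C a * X ^ 6 + C b : ℚ[X]).Gal := by
    have := Subgroup.card_dvd_of_surjective _ (Gal.restrictComp_surjective
      (X ^ 4 + C a * X ^ 2 + C b : ℚ[X]) (X ^ 3) (by simp))
    rw [hG4.card_eq, T4_3, card_dihedralPermGroup (by norm_num)] at this
    convert this using 4
    simp only [add_comp, mul_comp, pow_comp, X_comp, C_comp]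
    ring
  have h6 : 12 ∣ Nat.card (X ^ 12 + C a * X ^ 6 + C b : ℚ[X]).Gal := by
    have := Subgroup.card_dvd_of_surjective _ (Gal.restrictComp_surjective
      (X ^ 6 + C a * X ^ 3 + C b : ℚ[X]) (X ^ 2) (by simp))
    rw [hG6.card_eq, T6_3, card_dihedralPermGroup (by norm_num)] at this
    convert this using 4
    simp only [add_comp, mul_comp, pow_comp, X_comp, C_comp]
    ring
  exact Nat.le_of_dvd Nat.card_pos (Nat.lcm_dvd h4 h6)

/-! ### The roots of `f` and the action of automorphisms on them. -/

/-- `ζ` is a primitive sixth root of unity and the numbers `θ * ζ ^ i`, `φ * ζ ^ i` are the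
twelve distinct roots of `X ^ 12 + a * X ^ 6 + b`. -/
structure SexticRoots {E : Type*} [Field E] [Algebra ℚ E] (a b : ℚ) (θ φ ζ : E) : Prop where
  zeta : ζ ^ 2 - ζ + 1 = 0
  add : θ ^ 6 + φ ^ 6 = -algebraMap ℚ E a
  mul : θ ^ 6 * φ ^ 6 = algebraMap ℚ E b
  ne_zero : algebraMap ℚ E b ≠ 0
  ne : θ ^ 6 ≠ φ ^ 6

lemma exists_sexticRoots {E : Type*} [Field E] [Algebra ℚ E] {a b : ℚ}
    (hf : Irreducible (X ^ 12 + C a * X ^ 6 + C b : ℚ[X]))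
    (hs : ((X ^ 12 + C a * X ^ 6 + C b : ℚ[X]).map (algebraMap ℚ E)).Splits) :
    ∃ θ φ ζ : E, SexticRoots a b θ φ ζ := by
  set f : ℚ[X] := X ^ 12 + C a * X ^ 6 + C b with hfdef
  have hfdeg : f.natDegree = 12 := by rw [hfdef]; compute_degree!
  have hfE : f.map (algebraMap ℚ E) =
      X ^ 12 + C (algebraMap ℚ E a) * X ^ 6 + C (algebraMap ℚ E b) := by simp [hfdef]
  have hf0 : f.map (algebraMap ℚ E) ≠ 0 :=
    (Polynomial.map_ne_zero_iff (algebraMap ℚ E).injective).2 hf.ne_zero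
  have hb : b ≠ 0 := by
    intro hb
    have hfac : f = X * (X ^ 11 + C a * X ^ 5) := by rw [hfdef, hb, C_0]; ring
    rcases hf.isUnit_or_isUnit hfac with h | h
    · exact not_isUnit_X h
    · have h1 := natDegree_eq_zero_of_isUnit h
      have h2 : (X ^ 11 + C a * X ^ 5 : ℚ[X]).natDegree = 11 := by compute_degree!
      omega
  have hab : a ^ 2 - 4 * b ≠ 0 := by
    intro h
    have hfac : f = (X ^ 6 + C (a / 2)) * (X ^ 6 + C (a / 2)) := by
      have hb' : b = (a / 2) ^ 2 := by linear_combination -h / 4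
      have ha' : a = 2 * (a / 2) := by ring
      have ha2 : C a = 2 * C (a / 2) := by
        conv_lhs => rw [ha', C_mul]
        rfl
      rw [hfdef, hb', C_pow, ha2]
      ring
    have h1 : IsUnit (X ^ 6 + C (a / 2) : ℚ[X]) := (hf.isUnit_or_isUnit hfac).elim id id
    have h2 := natDegree_eq_zero_of_isUnit h1
    have h3 : (X ^ 6 + C (a / 2) : ℚ[X]).natDegree = 6 := by compute_degree!
    omega
  obtain ⟨θ, hθ⟩ := hs.exists_eval_eq_zero (by
    rw [degree_map, degree_eq_natDegree hf.ne_zero, hfdeg]; norm_num)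
  rw [hfE] at hθ
  simp only [eval_add, eval_mul, eval_pow, eval_X, eval_C] at hθ
  have hb' : algebraMap ℚ E b ≠ 0 := (_root_.map_ne_zero _).2 hb
  have hθ0 : θ ≠ 0 := by
    rintro rfl
    exact hb' (by simpa using hθ)
  have hfac : f.map (algebraMap ℚ E) =
      (X ^ 6 - C (θ ^ 6)) * (X ^ 6 - C (-algebraMap ℚ E a - θ ^ 6)) := by
    have hb2 : algebraMap ℚ E b = θ ^ 6 * (-algebraMap ℚ E a - θ ^ 6) := by
      linear_combination hθ
    rw [hfE, hb2]
    simp only [C_sub, C_mul, C_neg, C_pow]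
    ring
  obtain ⟨φ, hφ⟩ := (hs.of_dvd hf0 (hfac ▸ dvd_mul_left _ _)).exists_eval_eq_zero (by
    rw [degree_X_pow_sub_C (by norm_num)]; norm_num)
  simp only [eval_sub, eval_pow, eval_X, eval_C] at hφ
  -- This factor of `X ^ 6 - θ ^ 6` has as roots `θ` times the primitive sixth roots of unity.
  have hquad : (X ^ 2 - C θ * X + C (θ ^ 2) : E[X]).Splits := by
    refine hs.of_dvd hf0 ((Dvd.intro ((X ^ 2 - C (θ ^ 2)) * (X ^ 2 + C θ * X + C (θ ^ 2))) ?_).trans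
      (hfac ▸ dvd_mul_right _ _))
    simp only [C_pow]
    ring
  obtain ⟨y, hy⟩ := hquad.exists_eval_eq_zero (by
    have : (X ^ 2 - C θ * X + C (θ ^ 2) : E[X]).degree = 2 := by compute_degree!
    rw [this]; norm_num)
  simp only [eval_add, eval_sub, eval_mul, eval_pow, eval_X, eval_C] at hy
  refine ⟨θ, φ, y / θ, ?_, ?_, ?_, hb', ?_⟩
  · field_simp
    linear_combination hy
  · linear_combination hφ
  · linear_combination θ ^ 6 * hφ - hθ
  · intro h
    apply hab
    apply (algebraMap ℚ E).injective
    simp only [map_sub, map_pow, map_mul, map_zero, map_ofNat]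
    have ha : algebraMap ℚ E a = -2 * θ ^ 6 := by linear_combination h + hφ
    rw [ha] at hθ ⊢
    linear_combination -4 * hθ

/-- The difference of the two sides factors as `(z - 1) * (U - z' * V)`. -/
lemma eq_one_of_add_eq {E : Type*} [Field E] {U V z z' : E} (hU : U ^ 3 ≠ V ^ 3) (hz : z * z' = 1)
    (hz' : z' ^ 3 = 1) (h : z * U + z' * V = U + V) : z = 1 := by
  have h1 : (1 - z) * (U - z' * V) = 0 := by linear_combination V * hz - h
  rcases mul_eq_zero.1 h1 with h2 | h2
  · exact (sub_eq_zero.1 h2).symm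
  · refine absurd ?_ hU
    rw [sub_eq_zero.1 h2, mul_pow, hz', one_mul]

section

variable {E : Type*} [Field E] [Algebra ℚ E] {a b : ℚ} {θ φ ζ : E}

namespace SexticRoots

lemma charZero (_ : SexticRoots a b θ φ ζ) : CharZero E :=
  charZero_of_injective_algebraMap (algebraMap ℚ E).injective

lemma cube (h : SexticRoots a b θ φ ζ) : ζ ^ 3 = -1 := by
  linear_combination (ζ + 1) * h.zeta

lemma pow_six (h : SexticRoots a b θ φ ζ) : ζ ^ 6 = 1 := by
  linear_combination (ζ ^ 3 - 1) * h.cube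

lemma pow_eleven (h : SexticRoots a b θ φ ζ) : ζ ^ 11 = 1 - ζ := by
  linear_combination ζ ^ 5 * h.pow_six + ζ ^ 2 * h.cube - h.zeta

lemma isPrimitiveRoot (h : SexticRoots a b θ φ ζ) : IsPrimitiveRoot ζ 6 := by
  have := h.charZero
  rw [← isRoot_cyclotomic_iff_charZero (by norm_num), cyclotomic_six]
  simpa using h.zeta

lemma left_ne_zero (h : SexticRoots a b θ φ ζ) : θ ≠ 0 := by
  rintro rfl
  exact h.ne_zero (by rw [← h.mul]; ring)

lemma right_ne_zero (h : SexticRoots a b θ φ ζ) : φ ≠ 0 := by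
  rintro rfl
  exact h.ne_zero (by rw [← h.mul]; ring)

lemma twist (h : SexticRoots a b θ φ ζ) (k : ℕ) : SexticRoots a b θ (φ * ζ ^ k) ζ := by
  have hk : (φ * ζ ^ k) ^ 6 = φ ^ 6 := by
    rw [mul_pow, ← pow_mul, mul_comm k, pow_mul, h.pow_six, one_pow, mul_one]
  exact ⟨h.zeta, by rw [hk, h.add], by rw [hk, h.mul], h.ne_zero, by rw [hk]; exact h.ne⟩

lemma exists_pow (h : SexticRoots a b θ φ ζ) {x y : E} (hx : x ≠ 0) (hxy : y ^ 6 = x ^ 6) :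
    ∃ i < 6, y = x * ζ ^ i := by
  obtain ⟨i, hi, hζ⟩ := h.isPrimitiveRoot.eq_pow_of_pow_eq_one (ξ := y / x)
    (by rw [div_pow, hxy, div_self (pow_ne_zero 6 hx)])
  exact ⟨i, hi, by rw [hζ]; field_simp⟩

lemma isRoot_iff (h : SexticRoots a b θ φ ζ) {y : E} :
    y ^ 12 + algebraMap ℚ E a * y ^ 6 + algebraMap ℚ E b = 0 ↔ y ^ 6 = θ ^ 6 ∨ y ^ 6 = φ ^ 6 := by
  rw [← sub_eq_zero (b := θ ^ 6), ← sub_eq_zero (b := φ ^ 6), ← mul_eq_zero]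
  have : y ^ 12 + algebraMap ℚ E a * y ^ 6 + algebraMap ℚ E b =
      (y ^ 6 - θ ^ 6) * (y ^ 6 - φ ^ 6) := by
    linear_combination y ^ 6 * h.add - h.mul
  rw [this]

/-- Inversion of `ζ` is written with exponent 11 rather than 5, so that the exponent casts to `-1`
in `ZMod 12`. -/
lemma exists_map_eq (h : SexticRoots a b θ φ ζ) (σ : E ≃ₐ[ℚ] E) :
    ∃ e i j : ℕ, (e = 1 ∨ e = 11) ∧ σ ζ = ζ ^ e ∧
      ((σ θ = θ * ζ ^ i ∧ σ φ = φ * ζ ^ j) ∨ (σ θ = φ * ζ ^ i ∧ σ φ = θ * ζ ^ j)) := by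
  have he : ∃ e : ℕ, (e = 1 ∨ e = 11) ∧ σ ζ = ζ ^ e := by
    have h1 := congrArg σ h.zeta
    simp only [map_add, map_sub, map_pow, map_one, map_zero] at h1
    have h2 : (σ ζ - ζ) * (σ ζ - ζ ^ 11) = 0 := by
      rw [h.pow_eleven]
      linear_combination h1 - h.zeta
    rcases mul_eq_zero.1 h2 with h3 | h3
    · exact ⟨1, Or.inl rfl, by rw [pow_one]; exact sub_eq_zero.1 h3⟩
    · exact ⟨11, Or.inr rfl, sub_eq_zero.1 h3⟩
  obtain ⟨e, he, hσζ⟩ := he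
  have hadd : σ θ ^ 6 + σ φ ^ 6 = θ ^ 6 + φ ^ 6 := by
    have := congrArg σ h.add
    rw [map_neg, AlgEquiv.commutes, ← h.add] at this
    simpa using this
  have hθ := h.isRoot_iff.1 (show (σ θ) ^ 12 + algebraMap ℚ E a * (σ θ) ^ 6 +
      algebraMap ℚ E b = 0 by
    have := congrArg σ (h.isRoot_iff.2 (Or.inl rfl))
    simpa using this)
  rcases hθ with hθ | hθ
  · obtain ⟨i, -, hi⟩ := h.exists_pow h.left_ne_zero hθ
    obtain ⟨j, -, hj⟩ := h.exists_pow (y := σ φ) h.right_ne_zero (by linear_combination hadd - hθ)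
    exact ⟨e, i, j, he, hσζ, Or.inl ⟨hi, hj⟩⟩
  · obtain ⟨i, -, hi⟩ := h.exists_pow h.right_ne_zero hθ
    obtain ⟨j, -, hj⟩ := h.exists_pow (y := σ φ) h.left_ne_zero (by linear_combination hadd - hθ)
    exact ⟨e, i, j, he, hσζ, Or.inr ⟨hi, hj⟩⟩

lemma two_mul_eq_zero (h : SexticRoots a b θ φ ζ) {k : ℕ} (hk : ζ ^ k = 1) :
    (2 * k : ZMod 12) = 0 := by
  obtain ⟨l, rfl⟩ := h.isPrimitiveRoot.dvd_of_pow_eq_one k hk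
  have : ((12 * l : ℕ) : ZMod 12) = 0 := (ZMod.natCast_eq_zero_iff _ _).2 (Dvd.intro _ rfl)
  push_cast at this ⊢
  linear_combination this

/-- The sign by which an automorphism acts on `√-3` is read off from its action on `ζ`. -/
lemma map_sqrt_neg_three (h : SexticRoots a b θ φ ζ) {σ : E ≃ₐ[ℚ] E} {e : ℕ}
    (he : e = 1 ∨ e = 11) (hσ : σ ζ = ζ ^ e) :
    ∃ ε : E, (ε = 1 ∧ (e : ZMod 12) = 1 ∨ ε = -1 ∧ (e : ZMod 12) = -1) ∧
      σ (2 * ζ - 1) = ε * (2 * ζ - 1) := by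
  rcases he with rfl | rfl
  · refine ⟨1, Or.inl ⟨rfl, by norm_num⟩, ?_⟩
    rw [one_mul, map_sub, map_mul, map_ofNat, map_one, hσ, pow_one]
  · refine ⟨-1, Or.inr ⟨rfl, by decide⟩, ?_⟩
    simp only [map_sub, map_mul, map_ofNat, map_one, hσ, h.pow_eleven]
    ring

lemma six_mul_of_cube_pow_mul_eq_one (h : SexticRoots a b θ φ ζ) {k : ℕ} {ε : E} {e : ZMod 12}
    (hε : ε = 1 ∧ e = 1 ∨ ε = -1 ∧ e = -1) (hk : (ζ ^ 3) ^ k * ε = 1) :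
    (6 * k : ZMod 12) = 3 - 3 * e := by
  rcases hε with ⟨rfl, rfl⟩ | ⟨rfl, rfl⟩
  · have := h.two_mul_eq_zero (k := 3 * k) (by rw [pow_mul]; simpa using hk)
    push_cast at this
    linear_combination this
  · have := h.two_mul_eq_zero (k := 3 * k + 3) (by rw [pow_add, pow_mul, h.cube] at *; exact hk)
    push_cast at this
    have h12 : (12 : ZMod 12) = 0 := rfl
    linear_combination this - h12

end SexticRoots

/-! ### Congruences on the exponents forced by rational quantities. -/

lemma map_eq_self_of_sq_eq {r : ℚ} (hr : IsSquare r) {g : E} (hg : g ^ 2 = algebraMap ℚ E r)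
    (σ : E ≃ₐ[ℚ] E) : σ g = g := by
  obtain ⟨t, rfl⟩ := hr
  rw [map_mul, ← pow_two] at hg
  rcases sq_eq_sq_iff_eq_or_eq_neg.1 hg with rfl | rfl
  · exact σ.commutes t
  · rw [map_neg, σ.commutes]

/-- The arithmetic description of the action of `σ` on the roots: `w` records how the exponents
of `σ θ` and `σ φ` are related modulo `3`, and `s` how their parities are related. -/
def ActsWith (w s : ZMod 12) (θ φ ζ : E) (σ : E ≃ₐ[ℚ] E) : Prop :=
  ∃ e i j : ℕ, ((e : ZMod 12) = 1 ∨ (e : ZMod 12) = -1) ∧ σ ζ = ζ ^ e ∧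
    4 * (j : ZMod 12) = 4 * w * i ∧
    ((σ θ = θ * ζ ^ i ∧ σ φ = φ * ζ ^ j ∧ 6 * (i + j : ZMod 12) = 3 - 3 * e) ∨
      (σ θ = φ * ζ ^ i ∧ σ φ = θ * ζ ^ j ∧ 6 * (i + j : ZMod 12) = 3 - 3 * (s * e)))

namespace SexticRoots

/-- The conditions modulo `3` on the exponents of an automorphism. -/
def ExponentRel (w : ZMod 12) (θ φ ζ : E) : Prop :=
  ∀ (σ : E ≃ₐ[ℚ] E) (i j : ℕ),
    ((σ θ = θ * ζ ^ i ∧ σ φ = φ * ζ ^ j) ∨ (σ θ = φ * ζ ^ i ∧ σ φ = θ * ζ ^ j)) →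
    4 * (j : ZMod 12) = 4 * w * i

lemma actsWith_one (h : SexticRoots a b θ φ ζ) {w : ZMod 12} (hw : ExponentRel w θ φ ζ)
    (hsq : IsSquare (-3 * b)) (σ : E ≃ₐ[ℚ] E) : ActsWith w 1 θ φ ζ σ := by
  obtain ⟨e, i, j, he, hζ, hσ⟩ := h.exists_map_eq σ
  obtain ⟨ε, hε, hε3⟩ := h.map_sqrt_neg_three he hζ
  have hζ3 : (2 * ζ - 1) ^ 2 = -3 := by linear_combination 4 * h.zeta
  have := h.charZero
  have h3 : 2 * ζ - 1 ≠ 0 := by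
    intro h0
    rw [h0] at hζ3
    norm_num at hζ3
  have hθ := h.left_ne_zero
  have hφ := h.right_ne_zero
  have hfix := map_eq_self_of_sq_eq hsq (g := (θ * φ) ^ 3 * (2 * ζ - 1)) (by
    rw [mul_pow, hζ3, map_mul, ← h.mul]
    simp only [map_neg, map_ofNat]
    ring) σ
  have hk : (ζ ^ 3) ^ (i + j) * ε = 1 := by
    apply mul_left_cancel₀ (mul_ne_zero (pow_ne_zero 3 (mul_ne_zero hθ hφ)) h3)
    rw [mul_one]
    rw [map_mul, map_pow, map_mul, hε3] at hfix
    rcases hσ with ⟨h1, h2⟩ | ⟨h1, h2⟩ <;> rw [h1, h2] at hfix <;>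
      exact Eq.trans (by ring) hfix
  have h6 := h.six_mul_of_cube_pow_mul_eq_one hε hk
  push_cast at h6
  refine ⟨e, i, j, hε.imp And.right And.right, hζ, hw σ i j hσ, ?_⟩
  rcases hσ with ⟨h1, h2⟩ | ⟨h1, h2⟩
  · exact Or.inl ⟨h1, h2, h6⟩
  · exact Or.inr ⟨h1, h2, by rw [one_mul, h6]⟩

/-- The extra factor `θ ^ 6 - φ ^ 6` changes sign exactly when the two families are swapped, hence
`s = -1`. -/
lemma actsWith_neg_one (h : SexticRoots a b θ φ ζ) {w : ZMod 12} (hw : ExponentRel w θ φ ζ)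
    (hsq : IsSquare (3 * b * (4 * b - a ^ 2))) (σ : E ≃ₐ[ℚ] E) : ActsWith w (-1) θ φ ζ σ := by
  obtain ⟨e, i, j, he, hζ, hσ⟩ := h.exists_map_eq σ
  obtain ⟨ε, hε, hε3⟩ := h.map_sqrt_neg_three he hζ
  have hζ3 : (2 * ζ - 1) ^ 2 = -3 := by linear_combination 4 * h.zeta
  have := h.charZero
  have h3 : 2 * ζ - 1 ≠ 0 := by
    intro h0
    rw [h0] at hζ3
    norm_num at hζ3
  have hθ := h.left_ne_zero
  have hφ := h.right_ne_zero
  have hd : θ ^ 6 - φ ^ 6 ≠ 0 := sub_ne_zero.2 h.ne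
  have hfix := map_eq_self_of_sq_eq hsq
    (g := (θ * φ) ^ 3 * (2 * ζ - 1) * (θ ^ 6 - φ ^ 6)) (by
      have ha : algebraMap ℚ E a = -(θ ^ 6 + φ ^ 6) := by rw [h.add, neg_neg]
      rw [mul_pow, mul_pow, hζ3]
      simp only [map_mul, map_sub, map_pow, map_ofNat]
      rw [← h.mul, ha]
      ring) σ
  have hpow : ∀ (x : E) (k : ℕ), (x * ζ ^ k) ^ 6 = x ^ 6 := by
    intro x k
    rw [mul_pow, ← pow_mul, mul_comm k, pow_mul, h.pow_six, one_pow, mul_one]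
  have hcancel := mul_ne_zero (mul_ne_zero (pow_ne_zero 3 (mul_ne_zero hθ hφ)) h3) hd
  simp only [map_mul, map_pow, hε3, map_sub (σ : E ≃ₐ[ℚ] E) (θ ^ 6)] at hfix
  refine ⟨e, i, j, hε.imp And.right And.right, hζ, hw σ i j hσ, ?_⟩
  rcases hσ with ⟨h1, h2⟩ | ⟨h1, h2⟩ <;> rw [h1, h2, hpow, hpow] at hfix
  · have hk : (ζ ^ 3) ^ (i + j) * ε = 1 := by
      apply mul_left_cancel₀ hcancel
      rw [mul_one]
      exact Eq.trans (by ring) hfix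
    have h6 := h.six_mul_of_cube_pow_mul_eq_one hε hk
    push_cast at h6
    exact Or.inl ⟨h1, h2, h6⟩
  · have hk : (ζ ^ 3) ^ (i + j) * -ε = 1 := by
      apply mul_left_cancel₀ hcancel
      rw [mul_one]
      exact Eq.trans (by ring) hfix
    have h6 := h.six_mul_of_cube_pow_mul_eq_one (ε := -ε) (e := -1 * (e : ZMod 12)) (by
      rcases hε with ⟨h, h'⟩ | ⟨h, h'⟩
      · exact Or.inr ⟨by rw [h], by rw [h', mul_one]⟩
      · exact Or.inl ⟨by rw [h, neg_neg], by rw [h']; ring⟩) hk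
    push_cast at h6
    exact Or.inr ⟨h1, h2, h6⟩

lemma exponentRel_neg_one (h : SexticRoots a b θ φ ζ) {c : ℚ}
    (hc : (θ * φ) ^ 2 = algebraMap ℚ E c) : ExponentRel (-1) θ φ ζ := by
  intro σ i j hσ
  have h1 := congrArg σ hc
  rw [AlgEquiv.commutes, ← hc, map_pow, map_mul] at h1
  have hne : (θ * φ) ^ 2 ≠ 0 := pow_ne_zero 2 (mul_ne_zero h.left_ne_zero h.right_ne_zero)
  have hk : ζ ^ (2 * (i + j)) = 1 := by
    apply mul_left_cancel₀ hne
    rw [mul_one]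
    rcases hσ with ⟨h2, h3⟩ | ⟨h2, h3⟩ <;> rw [h2, h3] at h1 <;>
      exact Eq.trans (by ring) h1
  have := h.two_mul_eq_zero hk
  push_cast at this
  linear_combination this

/-- Put `U = θ⁴φ²`, `V = θ²φ⁴`. An automorphism multiplies them, up to a swap, by inverse cube roots
of unity; as `U³ ≠ V³`, preserving `U + V` makes these trivial. -/
lemma exponentRel_one (h : SexticRoots a b θ φ ζ) {q : ℚ}
    (hq : θ ^ 4 * φ ^ 2 + θ ^ 2 * φ ^ 4 = algebraMap ℚ E q) : ExponentRel 1 θ φ ζ := by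
  intro σ i j hσ
  have h1 := congrArg σ hq
  rw [AlgEquiv.commutes, ← hq] at h1
  simp only [map_add, map_mul, map_pow] at h1
  have hUV : (θ ^ 4 * φ ^ 2) ^ 3 ≠ (θ ^ 2 * φ ^ 4) ^ 3 := by
    intro h2
    apply h.ne
    apply mul_left_cancel₀ (a := θ ^ 6 * φ ^ 6) (by rw [h.mul]; exact h.ne_zero)
    linear_combination h2
  have hzz : ζ ^ (4 * i + 2 * j) * ζ ^ (2 * i + 4 * j) = 1 := by
    rw [← pow_add, show 4 * i + 2 * j + (2 * i + 4 * j) = 6 * (i + j) by ring, pow_mul,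
      h.pow_six, one_pow]
  have hz3 : (ζ ^ (2 * i + 4 * j)) ^ 3 = 1 := by
    rw [← pow_mul, show (2 * i + 4 * j) * 3 = 6 * (i + 2 * j) by ring, pow_mul,
      h.pow_six, one_pow]
  have hk : ζ ^ (4 * i + 2 * j) = 1 := by
    rcases hσ with ⟨h2, h3⟩ | ⟨h2, h3⟩ <;> rw [h2, h3] at h1
    · refine eq_one_of_add_eq hUV hzz hz3 ?_
      exact Eq.trans (by ring) h1
    · refine eq_one_of_add_eq hUV.symm hzz hz3 ?_
      rw [add_comm (θ ^ 2 * φ ^ 4)]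
      exact Eq.trans (by ring) h1
  have := h.two_mul_eq_zero hk
  push_cast at this
  have h12 : (12 : ZMod 12) = 0 := rfl
  linear_combination this - h12 * (i : ZMod 12)

lemma exists_twist_of_cube (h : SexticRoots a b θ φ ζ) {c : ℚ} (hc : c ^ 3 = b) :
    ∃ φ' : E, SexticRoots a b θ φ' ζ ∧ ExponentRel (-1) θ φ' ζ := by
  set d := algebraMap ℚ E c with hd
  have hb : (θ * φ) ^ 6 = d ^ 3 := by rw [mul_pow, h.mul, ← hc, map_pow]
  -- Twisting `φ` by `ζ` multiplies `(θφ)²` by a primitive cube root of unity, so the product is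
  -- `(θφ)⁶ - d³`.
  have h0 : ((θ * φ) ^ 2 - d) * ((θ * (φ * ζ ^ 1)) ^ 2 - d) * ((θ * (φ * ζ ^ 2)) ^ 2 - d) = 0 := by
    have hζ := h.zeta
    grind
  rcases mul_eq_zero.1 h0 with h1 | h1
  · rcases mul_eq_zero.1 h1 with h1 | h1
    · exact ⟨φ, h, h.exponentRel_neg_one (c := c) (sub_eq_zero.1 h1)⟩
    · exact ⟨_, h.twist 1, (h.twist 1).exponentRel_neg_one (c := c) (sub_eq_zero.1 h1)⟩
  · exact ⟨_, h.twist 2, (h.twist 2).exponentRel_neg_one (c := c) (sub_eq_zero.1 h1)⟩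

lemma exists_twist_of_root (h : SexticRoots a b θ φ ζ) {q : ℚ}
    (hq : q ^ 3 - 3 * b * q + a * b = 0) :
    ∃ φ' : E, SexticRoots a b θ φ' ζ ∧ ExponentRel 1 θ φ' ζ := by
  have hq' := congrArg (algebraMap ℚ E) hq
  simp only [map_add, map_sub, map_mul, map_pow, map_ofNat, map_zero] at hq'
  have ha : algebraMap ℚ E a = -(θ ^ 6 + φ ^ 6) := by rw [h.add, neg_neg]
  rw [← h.mul, ha] at hq'
  set d := algebraMap ℚ E q with hd
  let F : E → E := fun φ => θ ^ 4 * φ ^ 2 + θ ^ 2 * φ ^ 4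
  -- Cardano: `UV = b` and `U³ + V³ = -ab`, so the three twists of `U + V` are the roots of `r`.
  have h0 : (F φ - d) * (F (φ * ζ ^ 1) - d) * (F (φ * ζ ^ 2) - d) = 0 := by
    have h1 : F (φ * ζ ^ 1) = ζ ^ 2 * (θ ^ 4 * φ ^ 2) + -ζ * (θ ^ 2 * φ ^ 4) := by
      linear_combination θ ^ 2 * φ ^ 4 * ζ * h.cube
    have h2 : F (φ * ζ ^ 2) = -ζ * (θ ^ 4 * φ ^ 2) + ζ ^ 2 * (θ ^ 2 * φ ^ 4) := by
      linear_combination θ ^ 4 * φ ^ 2 * ζ * h.cube + θ ^ 2 * φ ^ 4 * ζ ^ 2 * h.pow_six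
    have h3 : ζ ^ 2 = ζ - 1 := by linear_combination h.zeta
    rw [h1, h2, h3]
    have hζ := h.zeta
    simp only [F]
    generalize hU : θ ^ 4 * φ ^ 2 = U
    generalize hV : θ ^ 2 * φ ^ 4 = V
    have hUV : U * V = θ ^ 6 * φ ^ 6 := by rw [← hU, ← hV]; ring
    have hUV3 : U ^ 3 + V ^ 3 = (θ ^ 6 + φ ^ 6) * (θ ^ 6 * φ ^ 6) := by rw [← hU, ← hV]; ring
    have hq2 : d ^ 3 - 3 * (U * V) * d - (U ^ 3 + V ^ 3) = 0 := by
      rw [hUV, hUV3]; linear_combination hq'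
    clear_value d
    grind
  rcases mul_eq_zero.1 h0 with h1 | h1
  · rcases mul_eq_zero.1 h1 with h1 | h1
    · exact ⟨φ, h, h.exponentRel_one (q := q) (sub_eq_zero.1 h1)⟩
    · exact ⟨_, h.twist 1, (h.twist 1).exponentRel_one (q := q) (sub_eq_zero.1 h1)⟩
  · exact ⟨_, h.twist 2, (h.twist 2).exponentRel_one (q := q) (sub_eq_zero.1 h1)⟩

end SexticRoots

end

/-! ### The labelling of the roots by `ZMod 12`. -/

section

variable {E : Type*} [Field E]

/-- The labelling by `ZMod 12` of the twelve numbers `θ * ζ ^ l` and `φ * ζ ^ l`, with labels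
`2 * l` and `3 + 2 * w * l` respectively. -/
def rootLabel (w : ZMod 12) (θ φ ζ : E) (x : ZMod 12) : E :=
  if Even x.val then θ * ζ ^ (x.val / 2) else φ * ζ ^ ((w * (x - 3)).val / 2)

lemma zmod_twelve_cases {w : ZMod 12} (hw : w = 1 ∨ w = -1) (x : ZMod 12) :
    ∃ l < 6, x = 2 * (l : ℕ) ∨ x = 3 + 2 * w * (l : ℕ) := by
  have : ∀ w x : ZMod 12, (w = 1 ∨ w = -1) →
      ∃ l < 6, x = 2 * (l : ℕ) ∨ x = 3 + 2 * w * (l : ℕ) := by decide +kernel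
  exact this w x hw

lemma two_mul_val_half (l : ℕ) : (2 * l : ZMod 12).val / 2 = l % 6 := by
  rw [show (2 * l : ZMod 12) = ((2 * l : ℕ) : ZMod 12) by push_cast; rfl, ZMod.val_natCast]
  omega

lemma odd_label_of_fix : ∀ w : ZMod 12, w = 1 ∨ w = -1 → ∀ e : ZMod 12, e = 1 ∨ e = -1 →
    ∀ i j : ZMod 12, 4 * j = 4 * w * i → 6 * (i + j) = 3 - 3 * e →
      3 + 2 * w * j = 3 * e + 2 * i := by
  decide +kernel

lemma odd_label_of_swap : ∀ w : ZMod 12, w = 1 ∨ w = -1 → ∀ s : ZMod 12, s = 1 ∨ s = -1 →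
    ∀ e : ZMod 12, e = 1 ∨ e = -1 →
    ∀ i j : ZMod 12, 4 * j = 4 * w * i → 6 * (i + j) = 3 - 3 * (s * e) →
      2 * j = (w * e + 3 * (1 + w * s)) * 3 + 3 + 2 * w * i := by
  decide +kernel

variable {θ φ ζ : E}

lemma rootLabel_even (hζ : ζ ^ 6 = 1) (w : ZMod 12) (l : ℕ) :
    rootLabel w θ φ ζ (2 * l) = θ * ζ ^ l := by
  have h : ∀ y : ZMod 12, Even (2 * y).val := by decide +kernel
  rw [rootLabel, if_pos (h l), two_mul_val_half, ← pow_eq_pow_mod l hζ]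

lemma rootLabel_odd (hζ : ζ ^ 6 = 1) {w : ZMod 12} (hw : w = 1 ∨ w = -1) (l : ℕ) :
    rootLabel w θ φ ζ (3 + 2 * w * l) = φ * ζ ^ l := by
  have h : ∀ w y : ZMod 12, ¬ Even (3 + 2 * w * y).val := by decide +kernel
  have hw2 : w * w = 1 := by rcases hw with rfl | rfl <;> rfl
  rw [rootLabel, if_neg (h w l), show w * (3 + 2 * w * l - 3) = 2 * (l : ZMod 12) by
    linear_combination 2 * (l : ZMod 12) * hw2, two_mul_val_half, ← pow_eq_pow_mod l hζ]

variable [Algebra ℚ E] {a b : ℚ}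

namespace SexticRoots

lemma rootLabel_injective (h : SexticRoots a b θ φ ζ) {w : ZMod 12} (hw : w = 1 ∨ w = -1) :
    Function.Injective (rootLabel w θ φ ζ) := by
  have hpow : ∀ (x : E) (k : ℕ), (x * ζ ^ k) ^ 6 = x ^ 6 := by
    intro x k
    rw [mul_pow, ← pow_mul, mul_comm k, pow_mul, h.pow_six, one_pow, mul_one]
  intro x y hxy
  obtain ⟨k, hk, rfl | rfl⟩ := zmod_twelve_cases hw x <;>
    obtain ⟨l, hl, rfl | rfl⟩ := zmod_twelve_cases hw y <;>
    simp only [rootLabel_even h.pow_six, rootLabel_odd h.pow_six hw] at hxy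
  · rw [h.isPrimitiveRoot.pow_inj hk hl (mul_left_cancel₀ h.left_ne_zero hxy)]
  · exact absurd (by rw [← hpow θ k, hxy, hpow]) h.ne
  · exact absurd (by rw [← hpow θ l, ← hxy, hpow]) h.ne
  · rw [h.isPrimitiveRoot.pow_inj hk hl (mul_left_cancel₀ h.right_ne_zero hxy)]

lemma range_rootLabel (h : SexticRoots a b θ φ ζ) {w : ZMod 12} (hw : w = 1 ∨ w = -1) :
    Set.range (rootLabel w θ φ ζ) = (X ^ 12 + C a * X ^ 6 + C b : ℚ[X]).rootSet E := by
  have hpow : ∀ (x : E) (k : ℕ), (x * ζ ^ k) ^ 6 = x ^ 6 := by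
    intro x k
    rw [mul_pow, ← pow_mul, mul_comm k, pow_mul, h.pow_six, one_pow, mul_one]
  have hne : (X ^ 12 + C a * X ^ 6 + C b : ℚ[X]) ≠ 0 := by
    apply Monic.ne_zero
    monicity!
  ext y
  rw [mem_rootSet_of_ne hne]
  simp only [map_add, map_mul, map_pow, aeval_X, aeval_C]
  rw [h.isRoot_iff]
  constructor
  · rintro ⟨x, rfl⟩
    obtain ⟨k, -, rfl | rfl⟩ := zmod_twelve_cases hw x
    · exact Or.inl (by rw [rootLabel_even h.pow_six, hpow])
    · exact Or.inr (by rw [rootLabel_odd h.pow_six hw, hpow])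
  · rintro (hy | hy)
    · obtain ⟨i, -, rfl⟩ := h.exists_pow h.left_ne_zero hy
      exact ⟨_, rootLabel_even h.pow_six w i⟩
    · obtain ⟨i, -, rfl⟩ := h.exists_pow h.right_ne_zero hy
      exact ⟨_, rootLabel_odd h.pow_six hw i⟩

/-- The action on the roots is given on the labels by an affine map of `ZMod 12`. -/
lemma exists_affine (h : SexticRoots a b θ φ ζ) {w s : ZMod 12} (hw : w = 1 ∨ w = -1)
    (hs : s = 1 ∨ s = -1) {σ : E ≃ₐ[ℚ] E} (hσ : ActsWith w s θ φ ζ σ) :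
    ∃ m n : ZMod 12, (((m = 1 ∨ m = -1) ∧ 6 * n = 0) ∨
        ((m = 3 * (1 + w * s) + 1 ∨ m = 3 * (1 + w * s) - 1) ∧ 6 * n = 6)) ∧
      ∀ x, σ (rootLabel w θ φ ζ x) = rootLabel w θ φ ζ (m * x + n) := by
  obtain ⟨e, i, j, he, hζ, h4, hσ⟩ := hσ
  have hpow : ∀ k l : ℕ, ζ ^ k * (ζ ^ e) ^ l = ζ ^ (k + e * l) := fun k l => by
    rw [pow_add, pow_mul]
  have h6 := h.pow_six
  have h12 : (12 : ZMod 12) = 0 := rfl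
  have hw2 : w * w = 1 := by rcases hw with rfl | rfl <;> rfl
  have hw6 : 6 * w = 6 := by rcases hw with rfl | rfl <;> rfl
  have hs6 : 6 * s = 6 := by rcases hs with rfl | rfl <;> rfl
  rcases hσ with ⟨hθ, hφ, hp⟩ | ⟨hθ, hφ, hp⟩
  · refine ⟨e, 2 * i, Or.inl ⟨he, by linear_combination i * h12⟩, fun x => ?_⟩
    obtain ⟨l, -, rfl | rfl⟩ := zmod_twelve_cases hw x
    · rw [rootLabel_even h6, map_mul, map_pow, hθ, hζ, mul_assoc, hpow, ← rootLabel_even h6 w]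
      congr 1
      push_cast
      ring
    · rw [rootLabel_odd h6 hw, map_mul, map_pow, hφ, hζ, mul_assoc, hpow, ← rootLabel_odd h6 hw]
      congr 1
      push_cast
      have key := odd_label_of_fix w hw e he i j h4 hp
      linear_combination key
  -- Even labels determine the multiplier only modulo 6, as `w * e`; odd labels decide whether 6 is
  -- added, which happens exactly when `w * s = 1`.
  · refine ⟨w * e + 3 * (1 + w * s), 3 + 2 * w * i, Or.inr ⟨?_, by
      linear_combination (1 + w * i) * h12⟩, fun x => ?_⟩
    · rcases hw with rfl | rfl <;> rcases he with he | he <;> rw [he]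
      · left; ring
      · right; ring
      · right; ring
      · left; ring
    obtain ⟨l, -, rfl | rfl⟩ := zmod_twelve_cases hw x
    · rw [rootLabel_even h6, map_mul, map_pow, hθ, hζ, mul_assoc, hpow, ← rootLabel_odd h6 hw]
      congr 1
      push_cast
      linear_combination -l * (s * hw6 + hs6 + h12)
    · rw [rootLabel_odd h6 hw, map_mul, map_pow, hφ, hζ, mul_assoc, hpow, ← rootLabel_even h6 w]
      congr 1
      push_cast
      have key := odd_label_of_swap w hw s hs e he i j h4 hp
      linear_combination key - 2 * e * l * hw2
        - w * l * (s * hw6 + hs6 + h12)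

end SexticRoots

end

/-! ### Identification of the Galois group. -/

lemma galoisGroupIs_T12_12 {a b : ℚ} {θ φ ζ : (X ^ 12 + C a * X ^ 6 + C b : ℚ[X]).SplittingField}
    (hcard : 24 ≤ Nat.card (X ^ 12 + C a * X ^ 6 + C b : ℚ[X]).Gal)
    (h : SexticRoots a b θ φ ζ) {w : ZMod 12} (hw : w = 1 ∨ w = -1)
    (hσ : ∀ σ, ActsWith w (-w) θ φ ζ σ) :
    GaloisGroupIs (X ^ 12 + C a * X ^ 6 + C b : ℚ[X]) T12_12 := by
  refine galoisGroupIs_of_forall_exists (by rwa [T12_12, card_dihedralPermGroup (by norm_num)])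
    (rootLabel w θ φ ζ) (h.rootLabel_injective hw) (h.range_rootLabel hw) fun σ => ?_
  obtain ⟨m, n, hmn, hx⟩ := h.exists_affine hw (by rcases hw with rfl | rfl <;> simp) (hσ σ)
  have hw2 : w * -w = -1 := by rcases hw with rfl | rfl <;> rfl
  rw [hw2] at hmn
  obtain ⟨π, hπ, hπx⟩ := exists_mem_T12_12 m n (by
    rcases hmn with ⟨hm, -⟩ | ⟨hm, -⟩
    · exact hm
    · simpa using hm)
  exact ⟨π, hπ, fun x => by rw [hπx]; exact hx x⟩

lemma galoisGroupIs_T12_13 {a b : ℚ} {θ φ ζ : (X ^ 12 + C a * X ^ 6 + C b : ℚ[X]).SplittingField}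
    (hcard : 24 ≤ Nat.card (X ^ 12 + C a * X ^ 6 + C b : ℚ[X]).Gal)
    (h : SexticRoots a b θ φ ζ) {w : ZMod 12} (hw : w = 1 ∨ w = -1)
    (hσ : ∀ σ, ActsWith w w θ φ ζ σ) :
    GaloisGroupIs (X ^ 12 + C a * X ^ 6 + C b : ℚ[X]) T12_13 := by
  refine galoisGroupIs_of_forall_exists (card_T12_13_le.trans hcard)
    (rootLabel w θ φ ζ) (h.rootLabel_injective hw) (h.range_rootLabel hw) fun σ => ?_
  obtain ⟨m, n, hmn, hx⟩ := h.exists_affine hw hw (hσ σ)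
  have hw2 : w * w = 1 := by rcases hw with rfl | rfl <;> rfl
  rw [hw2] at hmn
  obtain ⟨π, hπ, hπx⟩ := exists_mem_T12_13 m n (by
    rcases hmn with hm | ⟨hm | hm, hn⟩
    · exact Or.inl hm
    · exact Or.inr ⟨Or.inr (hm.trans rfl), hn⟩
    · exact Or.inr ⟨Or.inl (hm.trans rfl), hn⟩)
  exact ⟨π, hπ, fun x => by rw [hπx]; exact hx x⟩

lemma exists_root_of_not_irreducible {a b : ℚ}
    (h : ¬ Irreducible (X ^ 3 - C (3 * b) * X + C (a * b) : ℚ[X])) :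
    ∃ q : ℚ, q ^ 3 - 3 * b * q + a * b = 0 := by
  have hdeg : (X ^ 3 - C (3 * b) * X + C (a * b) : ℚ[X]).natDegree = 3 := by compute_degree!
  rw [irreducible_iff_roots_eq_zero_of_degree_le_three (by omega) (by omega)] at h
  obtain ⟨q, hq⟩ := Multiset.exists_mem_of_ne_zero h
  exact ⟨q, by simpa using isRoot_of_mem_roots hq⟩

theorem mainTheorem4 (a b : ℚ)
    (hf : Irreducible (X ^ 12 + C a * X ^ 6 + C b : ℚ[X]))
    (hG4 : GaloisGroupIs (X ^ 4 + C a * X ^ 2 + C b : ℚ[X]) T4_3)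
    (hG6 : GaloisGroupIs (X ^ 6 + C a * X ^ 3 + C b : ℚ[X]) T6_3)
    (hsq : IsSquare (-3 * b) ∨ IsSquare (3 * b * (4 * b - a ^ 2))) :
    (¬ Irreducible (X ^ 3 - C (3 * b) * X + C (a * b) : ℚ[X]) →
      (IsSquare (3 * b * (4 * b - a ^ 2)) →
        GaloisGroupIs (X ^ 12 + C a * X ^ 6 + C b : ℚ[X]) T12_12) ∧
      (IsSquare (-3 * b) →
        GaloisGroupIs (X ^ 12 + C a * X ^ 6 + C b : ℚ[X]) T12_13)) ∧
    ((∃ c : ℚ, c ^ 3 = b) →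
      (IsSquare (-3 * b) →
        GaloisGroupIs (X ^ 12 + C a * X ^ 6 + C b : ℚ[X]) T12_12) ∧
      (IsSquare (3 * b * (4 * b - a ^ 2)) →
        GaloisGroupIs (X ^ 12 + C a * X ^ 6 + C b : ℚ[X]) T12_13)) := by
  have hcard := card_gal_ge hG4 hG6
  obtain ⟨θ, φ, ζ, h⟩ := exists_sexticRoots hf (SplittingField.splits _)
  constructor
  · intro hr
    obtain ⟨q, hq⟩ := exists_root_of_not_irreducible hr
    obtain ⟨φ', h', hw⟩ := h.exists_twist_of_root hq
    exact ⟨fun hs => galoisGroupIs_T12_12 hcard h' (Or.inl rfl) (h'.actsWith_neg_one hw hs),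
      fun hs => galoisGroupIs_T12_13 hcard h' (Or.inl rfl) (h'.actsWith_one hw hs)⟩
  · rintro ⟨c, hc⟩
    obtain ⟨φ', h', hw⟩ := h.exists_twist_of_cube hc
    exact ⟨fun hs => galoisGroupIs_T12_12 hcard h' (Or.inr rfl) (h'.actsWith_one hw hs),
      fun hs => galoisGroupIs_T12_13 hcard h' (Or.inr rfl) (h'.actsWith_neg_one hw hs)⟩
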